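/- Conventions. A fan in $\mathbb{R}^3$ is a nonempty finite collection of polyhedral cones, closed under taking faces, any two of which intersect in a common face of both; its rays are its one-dimensional cones. It is complete if its cones cover $\mathbb{R}^3$. It is unimodular if every cone lies in a three-dimensional cone of the fan and every cone is generated by linearly independent primitive integer vectors that generate the lattice of all integer points in the linear span of the cone. It is polytopal if it is the collection of the normal cones of all faces of some polytope. A fan $\Sigma$ refines a fan $\Sigma'$ if every cone of $\Sigma$ is contained in some cone of $\Sigma'$; the refinement is proper if moreover $\Sigma\neq\Sigma'$. Theorem. For every integer $k\ge 0$ there is a complete unimodular polytopal fan in $\mathbb{R}^3$ with exactly $k+6$ rays that is not a proper refinement of any unimodular fan. Consequently, there is no $N$ such that every complete unimodular polytopal fan in $\mathbb{R}^3$ refines a unimodular fan with at most $N$ rays. -/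

import Mathlib

/-! Polyhedral fans in `ℝⁿ = Fin n → ℝ`; the dual space is identified with `ℝⁿ` through the
standard scalar product `⬝ᵥ`. -/

/-- A polyhedral fan in `ℝⁿ`: a nonempty finite collection of polyhedral (that is, finitely
generated) cones, closed under taking faces, such that any two of its cones intersect in a common
face of both. -/
@[ext]
structure PolyhedralFan (n : ℕ) where
  cones : Set (PointedCone ℝ (Fin n → ℝ))
  nonempty : cones.Nonempty
  finite : cones.Finite
  polyhedral : ∀ C ∈ cones, C.FG
  face_mem : ∀ C ∈ cones, ∀ F : PointedCone ℝ (Fin n → ℝ), F.IsFaceOf C → F ∈ cones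
  inter_face : ∀ C ∈ cones, ∀ D ∈ cones, (C ⊓ D).IsFaceOf C ∧ (C ⊓ D).IsFaceOf D

namespace PolyhedralFan

/-- The dimension of a cone: the dimension of its linear span. -/
noncomputable def coneDim {n : ℕ} (C : PointedCone ℝ (Fin n → ℝ)) : ℕ :=
  Module.finrank ℝ (Submodule.span ℝ (C : Set (Fin n → ℝ)))

/-- The rays of a fan: its one-dimensional cones. -/
def rays {n : ℕ} (𝒩 : PolyhedralFan n) : Set (PointedCone ℝ (Fin n → ℝ)) :=
  {C ∈ 𝒩.cones | coneDim C = 1}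

/-- A fan is complete if its cones cover the whole space. -/
def IsComplete {n : ℕ} (𝒩 : PolyhedralFan n) : Prop :=
  ∀ x : Fin n → ℝ, ∃ C ∈ 𝒩.cones, x ∈ C

/-! ### Unimodular fans -/

/-- The lattice `ℤⁿ` inside `ℝⁿ`. -/
def intLattice (n : ℕ) : AddSubgroup (Fin n → ℝ) :=
  ((Int.castAddHom ℝ).compLeft (Fin n)).range

/-- A primitive vector: an integer vector with relatively prime entries. -/
def IsPrimitive {n : ℕ} (v : Fin n → ℝ) : Prop :=
  ∃ z : Fin n → ℤ, Finset.univ.gcd z = 1 ∧ ∀ i, v i = (z i : ℝ)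

/-- `C` is a rational simplicial cone whose primitive ray generators are the elements of `s`. -/
structure IsPrimitiveGeneratingSet {n : ℕ} (s : Set (Fin n → ℝ))
    (C : PointedCone ℝ (Fin n → ℝ)) : Prop where
  finite : s.Finite
  primitive : ∀ v ∈ s, IsPrimitive v
  linearIndepOn : LinearIndepOn ℝ id s
  hull_eq : PointedCone.hull ℝ s = C

/-- The index of the lattice generated by `s` in the lattice `span ℝ s ∩ ℤⁿ`. If `s` is the set of
primitive ray generators of a rational simplicial cone, this is the multiplicity of that cone. -/
noncomputable def coneMultiplicity {n : ℕ} (s : Set (Fin n → ℝ)) : ℕ :=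
  (AddSubgroup.closure s).relIndex (intLattice n ⊓ (Submodule.span ℝ s).toAddSubgroup)

/-- A unimodular cone: a rational simplicial cone of multiplicity one. -/
def IsUnimodularCone {n : ℕ} (C : PointedCone ℝ (Fin n → ℝ)) : Prop :=
  ∃ s : Set (Fin n → ℝ), IsPrimitiveGeneratingSet s C ∧ coneMultiplicity s = 1

/-- A unimodular fan: a full-dimensional rational simplicial fan all of whose cones have
multiplicity one. -/
structure IsUnimodular {n : ℕ} (𝒩 : PolyhedralFan n) : Prop where
  unimodularCone : ∀ C ∈ 𝒩.cones, IsUnimodularCone C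
  fullDimensional : ∀ C ∈ 𝒩.cones, ∃ D ∈ 𝒩.cones, C ≤ D ∧ coneDim D = n

/-! ### Polytopal fans -/

/-- The face of `P` in the direction of `a`: the set of points of `P` at which the linear
functional `a` attains its maximum over `P`. -/
def faceInDirection {n : ℕ} (P : Set (Fin n → ℝ)) (a : Fin n → ℝ) : Set (Fin n → ℝ) :=
  {p ∈ P | ∀ x ∈ P, 0 ≤ a ⬝ᵥ (p - x)}

/-- The normal cone of a face `F` of `P`. -/
def normalCone {n : ℕ} (P F : Set (Fin n → ℝ)) : PointedCone ℝ (Fin n → ℝ) where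
  carrier := {a | ∀ p ∈ F, ∀ q ∈ P, 0 ≤ a ⬝ᵥ (p - q)}
  add_mem' := by
    intro a b ha hb p hp q hq
    rw [add_dotProduct]
    exact add_nonneg (ha p hp q hq) (hb p hp q hq)
  zero_mem' := by
    intro p _ q _
    simp
  smul_mem' := by
    intro c a ha p hp q hq
    have h : (c • a) ⬝ᵥ (p - q) = (c : ℝ) * (a ⬝ᵥ (p - q)) := smul_dotProduct (c : ℝ) a (p - q)
    rw [h]
    exact mul_nonneg c.2 (ha p hp q hq)

/-- The normal cones of all faces of `P`. -/
def normalFanCones {n : ℕ} (P : Set (Fin n → ℝ)) : Set (PointedCone ℝ (Fin n → ℝ)) :=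
  {N | ∃ a : Fin n → ℝ, N = normalCone P (faceInDirection P a)}

/-- A fan is polytopal if it is the normal fan of a (nonempty) polytope, that is, of the convex
hull of a nonempty finite set of points. -/
def IsPolytopal {n : ℕ} (𝒩 : PolyhedralFan n) : Prop :=
  ∃ S : Finset (Fin n → ℝ), S.Nonempty ∧
    𝒩.cones = normalFanCones (convexHull ℝ (S : Set (Fin n → ℝ)))

/-! ### Refinement -/

/-- `𝒩` refines `𝒩'`: every cone of `𝒩` is contained in some cone of `𝒩'`. (If `𝒩` is complete,
this forces `𝒩'` to be complete.) -/
def Refines {n : ℕ} (𝒩 𝒩' : PolyhedralFan n) : Prop :=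
  ∀ C ∈ 𝒩.cones, ∃ D ∈ 𝒩'.cones, C ≤ D

/-- `𝒩` is a proper refinement of `𝒩'`. -/
def ProperlyRefines {n : ℕ} (𝒩 𝒩' : PolyhedralFan n) : Prop :=
  𝒩.Refines 𝒩' ∧ 𝒩 ≠ 𝒩'

end PolyhedralFan

/-! ### Cones with finitely many generators and their faces -/

namespace PointedCone

variable {ι E : Type*} [AddCommGroup E] [Module ℝ E]

/-! The fan is the suspension, with apexes `(0, 0, ±1)`, of a cycle through the vectors `(1, j, j ^
2)`, `(0, 1, 0)`, `(-1, 0, 0)` and `(0, -1, 0)`. Consecutive vectors of the cycle project to a basis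
of `ℤ²` of determinant 1, so each maximal cone is unimodular. A strictly convex support function
shows both that the cones form a fan and that this fan is polytopal.

Suppose it refines a unimodular fan `𝒩`. Each ray of `𝒩` is then a ray of the fan, and if all rays
of the fan survive in `𝒩`, a count of generators forces equality (`fan_eq_of_cone_singleton_mem`). A
generator `v` that does not survive is a positive combination of the generators of some cone of `𝒩`,
and every cone of `𝒩` containing `v` contains that cone. Since cones of `𝒩` are pointed, two
restrictions follow (`exists_positive_combination_of_not_mem`): the negative of a neighbour of `v`
never occurs in the combination, and if `u` and `-u` are both neighbours of `v`, the combination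
does not have `u` in its span.

These exclude every `v`. For `v = (1, m, m ^ 2)` both apexes are neighbours, so at most two
generators occur, neither an apex; strict convexity of the parabola and small cases rule this out
(`slope_not_combination`). For the other five rays the signs of the coordinates suffice. As the
number of rays is unbounded, so is the size of these minimal fans. -/

theorem mem_of_smul_mem {C : PointedCone ℝ E} {x : E} {c : ℝ} (hc : 0 < c) (hx : c • x ∈ C) :
    x ∈ C := by
  have h := C.smul_mem (inv_nonneg.2 hc.le) hx
  rwa [smul_smul, inv_mul_cancel₀ hc.ne', one_smul] at h

theorem mem_hull_singleton_iff {v x : E} :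
    x ∈ hull ℝ {v} ↔ ∃ c : ℝ, 0 ≤ c ∧ x = c • v := by
  constructor
  · intro h
    obtain ⟨c, rfl⟩ := Submodule.mem_span_singleton.1 h
    exact ⟨c, c.2, rfl⟩
  · rintro ⟨c, hc, rfl⟩
    exact (hull ℝ {v}).smul_mem hc (subset_hull (Set.mem_singleton v))

theorem hull_singleton_smul {v : E} {c : ℝ} (hc : 0 < c) :
    hull ℝ {c • v} = hull ℝ {v} := by
  apply le_antisymm
  · refine Submodule.span_le.2 ?_
    rintro _ rfl
    exact (hull ℝ {v}).smul_mem hc.le (subset_hull (Set.mem_singleton v))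
  · refine Submodule.span_le.2 ?_
    rintro v rfl
    exact mem_of_smul_mem hc (subset_hull (Set.mem_singleton (c • v)))

/-- A cone generated by a finite family consists of the nonnegative combinations of the family. -/
theorem mem_hull_image_iff [Fintype ι] {v : ι → E} {K : Set ι} {x : E} :
    x ∈ hull ℝ (v '' K) ↔
      ∃ c : ι → ℝ, (∀ i, 0 ≤ c i) ∧ (∀ i, i ∉ K → c i = 0) ∧ ∑ i, c i • v i = x := by
  classical
  constructor
  · intro h
    induction h using Submodule.span_induction with
    | mem x h =>
      obtain ⟨j, hj, rfl⟩ := h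
      refine ⟨Pi.single j 1, fun i => ?_, fun i hi => ?_, ?_⟩
      · by_cases h : i = j <;> simp [h]
      · have : i ≠ j := fun h => hi (h ▸ hj)
        simp [this]
      · simp [Pi.single_apply]
    | zero => exact ⟨0, by simp, by simp, by simp⟩
    | add x y _ _ hx hy =>
      obtain ⟨c, hc, hcK, rfl⟩ := hx
      obtain ⟨d, hd, hdK, rfl⟩ := hy
      refine ⟨c + d, fun i => add_nonneg (hc i) (hd i), fun i hi => ?_, ?_⟩
      · simp [hcK i hi, hdK i hi]
      · simp [add_smul, Finset.sum_add_distrib]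
    | smul a x _ hx =>
      obtain ⟨c, hc, hcK, rfl⟩ := hx
      refine ⟨(a : ℝ) • c, fun i => mul_nonneg a.2 (hc i), fun i hi => ?_, ?_⟩
      · simp [hcK i hi]
      · simp only [Pi.smul_apply, smul_eq_mul, mul_smul, ← Finset.smul_sum]
        rfl
  · rintro ⟨c, hc, hcK, rfl⟩
    refine Submodule.sum_mem _ fun i _ => ?_
    by_cases hi : i ∈ K
    · exact (hull ℝ (v '' K)).smul_mem (hc i) (subset_hull (Set.mem_image_of_mem v hi))
    · simp [hcK i hi]

theorem mem_of_sum_mem_of_isFaceOf [Fintype ι] {v : ι → E} {C F : PointedCone ℝ E}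
    (hF : F.IsFaceOf C) {c : ι → ℝ} (hc : ∀ i, 0 ≤ c i) (hv : ∀ i, 0 < c i → v i ∈ C)
    (hsum : ∑ i, c i • v i ∈ F) {i : ι} (hi : 0 < c i) : v i ∈ F := by
  refine mem_of_smul_mem hi (hF.mem_of_sum_mem (f := fun i => c i • v i) (fun j => ?_) hsum i)
  rcases (hc j).eq_or_lt with h | h
  · simp [← h]
  · exact C.smul_mem (hc j) (hv j h)

/-- A face of a finitely generated cone is generated by the generators it contains. -/
theorem IsFaceOf.eq_hull_image [Fintype ι] {v : ι → E} {K : Set ι} {F : PointedCone ℝ E}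
    (hF : F.IsFaceOf (hull ℝ (v '' K))) : F = hull ℝ (v '' {i ∈ K | v i ∈ F}) := by
  apply le_antisymm
  · intro x hx
    obtain ⟨c, hc, hcK, rfl⟩ := mem_hull_image_iff.1 (hF.le hx)
    have hK : ∀ i, 0 < c i → i ∈ K := fun i hi => by
      by_contra h
      exact hi.ne' (hcK i h)
    refine mem_hull_image_iff.2 ⟨c, hc, fun i hi => ?_, rfl⟩
    by_contra h
    have hpos : 0 < c i := lt_of_le_of_ne (hc i) (Ne.symm h)
    exact hi ⟨hK i hpos, mem_of_sum_mem_of_isFaceOf hF hc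
      (fun j hj => subset_hull (Set.mem_image_of_mem v (hK j hj))) hx hpos⟩
  · refine Submodule.span_le.2 ?_
    rintro _ ⟨i, hi, rfl⟩
    exact hi.2

theorem eq_of_sum_smul_eq [Fintype ι] {v : ι → E} {K : Set ι} (hv : LinearIndepOn ℝ v K)
    {c d : ι → ℝ} (hc : ∀ i, i ∉ K → c i = 0) (hd : ∀ i, i ∉ K → d i = 0)
    (h : ∑ i, c i • v i = ∑ i, d i • v i) : c = d := by
  classical
  funext i
  by_cases hi : i ∈ K
  · refine sub_eq_zero.1 (linearIndepOn_iff'.1 hv (Finset.univ.filter (· ∈ K)) (c - d) ?_ ?_ i ?_)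
    · intro j hj
      simpa using hj
    · rw [Finset.sum_filter_of_ne]
      · simp [sub_smul, Finset.sum_sub_distrib, h]
      · intro j _ hj
        by_contra hjK
        simp [hc j hjK, hd j hjK] at hj
    · simpa using hi
  · rw [hc i hi, hd i hi]

/-- Subfamilies of a linearly independent family generate faces of a simplicial cone. -/
theorem isFaceOf_hull_image [Fintype ι] {v : ι → E} {K L : Set ι} (hv : LinearIndepOn ℝ v K)
    (hL : L ⊆ K) : (hull ℝ (v '' L)).IsFaceOf (hull ℝ (v '' K)) where
  le := Submodule.span_mono (Set.image_mono hL)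
  mem_of_smul_add_mem := by
    intro x y a hx hy ha hxy
    obtain ⟨c, hc, hcK, rfl⟩ := mem_hull_image_iff.1 hx
    obtain ⟨d, hd, hdK, rfl⟩ := mem_hull_image_iff.1 hy
    obtain ⟨e, he, heL, h⟩ := mem_hull_image_iff.1 hxy
    have key : e = a • c + d := by
      refine eq_of_sum_smul_eq hv (fun i hi => heL i fun h => hi (hL h)) (fun i hi => ?_) ?_
      · simp [hcK i hi, hdK i hi]
      · rw [h]
        simp [add_smul, mul_smul, Finset.sum_add_distrib, Finset.smul_sum]
    refine mem_hull_image_iff.2 ⟨c, hc, fun i hi => ?_, rfl⟩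
    have h0 := heL i hi
    rw [key] at h0
    simp only [Pi.add_apply, Pi.smul_apply, smul_eq_mul] at h0
    have h1 := mul_nonneg ha.le (hc i)
    have h2 := hd i
    have h3 : a * c i = 0 := by linarith
    exact (mul_eq_zero.1 h3).resolve_left ha.ne'

theorem eq_zero_of_mem_of_neg_mem [Fintype ι] {v : ι → E} {K : Set ι}
    (hv : LinearIndepOn ℝ v K) {x : E} (hx : x ∈ hull ℝ (v '' K))
    (hx' : -x ∈ hull ℝ (v '' K)) : x = 0 := by
  -- The empty subfamily exhibits the zero cone as a face.
  have hface := isFaceOf_hull_image hv (Set.empty_subset K)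
  have h := hface.mem_of_add_mem_left hx hx' (by simp)
  simpa using h

theorem span_hull (s : Set E) : Submodule.span ℝ (hull ℝ s : Set E) = Submodule.span ℝ s :=
  le_antisymm (Submodule.span_le.2 (hull_le_span (R := ℝ) s)) (Submodule.span_mono subset_hull)

end PointedCone

/-! ### Fans from strictly convex support functions -/

open PointedCone

/-- The real vector with given integer coordinates. -/
def intVec {n : ℕ} (z : Fin n → ℤ) : Fin n → ℝ := fun a => (z a : ℝ)

theorem intVec_dotProduct {n : ℕ} (z w : Fin n → ℤ) :
    intVec z ⬝ᵥ intVec w = ((z ⬝ᵥ w : ℤ) : ℝ) := by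
  simp [intVec, dotProduct]

/-- Combinatorial data of a complete unimodular fan in `ℝⁿ` together with a strictly convex
support function: the primitive ray generators `gen`, the generators `cell I` of the maximal
cones, the dual basis `dual I` of each maximal cone, the values `height` of the support function
at the ray generators, and the linear function `vertex I` that gives it on each maximal cone. -/
structure ConvexFanData (n : ℕ) (ι κ : Type*) [Fintype ι] [DecidableEq ι] where
  gen : ι → Fin n → ℤ
  cell : κ → Set ι
  dual : κ → ι → Fin n → ℤ
  height : ι → ℤ
  vertex : κ → Fin n → ℤ
  dual_gen : ∀ I, ∀ i ∈ cell I, ∀ j ∈ cell I, gen i ⬝ᵥ dual I j = if i = j then 1 else 0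
  gen_vertex_le : ∀ I j, gen j ⬝ᵥ vertex I ≤ height j
  gen_vertex_eq_iff : ∀ I j, gen j ⬝ᵥ vertex I = height j ↔ j ∈ cell I
  flip : ∀ I, ∀ j ∈ cell I, ∃ I', (∀ i ∈ cell I, i ≠ j → i ∈ cell I') ∧ j ∉ cell I'
  cover : ∀ x : Fin n → ℝ, ∃ I, x ∈ hull ℝ ((fun i => intVec (gen i)) '' cell I)
  ncard_cell : ∀ I, (cell I).ncard = n
  exists_mem_cell : ∀ j, ∃ I, j ∈ cell I

namespace ConvexFanData

variable {n : ℕ} {ι κ : Type*} [Fintype ι] [DecidableEq ι] (D : ConvexFanData n ι κ)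

/-- The ray generators as real vectors. -/
def vec (i : ι) : Fin n → ℝ := intVec (D.gen i)

/-- The cone generated by a set of ray generators. -/
def cone (K : Set ι) : PointedCone ℝ (Fin n → ℝ) := hull ℝ (D.vec '' K)

theorem mem_cone_iff {K : Set ι} {x : Fin n → ℝ} :
    x ∈ D.cone K ↔
      ∃ c : ι → ℝ, (∀ i, 0 ≤ c i) ∧ (∀ i, i ∉ K → c i = 0) ∧ ∑ i, c i • D.vec i = x :=
  mem_hull_image_iff

theorem vec_mem_cone {K : Set ι} {i : ι} (hi : i ∈ K) : D.vec i ∈ D.cone K :=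
  subset_hull (Set.mem_image_of_mem _ hi)

theorem sum_mem_cone {K : Set ι} {c : ι → ℝ} (hc : ∀ i, 0 ≤ c i) (hK : ∀ i, i ∉ K → c i = 0) :
    ∑ i, c i • D.vec i ∈ D.cone K :=
  D.mem_cone_iff.2 ⟨c, hc, hK, rfl⟩

theorem cone_mono {K L : Set ι} (h : K ⊆ L) : D.cone K ≤ D.cone L :=
  Submodule.span_mono (Set.image_mono h)

theorem cone_le_iff {K : Set ι} {C : PointedCone ℝ (Fin n → ℝ)} :
    D.cone K ≤ C ↔ ∀ i ∈ K, D.vec i ∈ C := by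
  refine ⟨fun h i hi => h (D.vec_mem_cone hi), fun h => Submodule.span_le.2 ?_⟩
  rintro _ ⟨i, hi, rfl⟩
  exact h i hi

theorem exists_mem_cone_cell (x : Fin n → ℝ) : ∃ I, x ∈ D.cone (D.cell I) := D.cover x

theorem sum_dotProduct_dual {I : κ} {c : ι → ℝ} (hc : ∀ i, i ∉ D.cell I → c i = 0) {j : ι}
    (hj : j ∈ D.cell I) : (∑ i, c i • D.vec i) ⬝ᵥ intVec (D.dual I j) = c j := by
  rw [sum_dotProduct, Finset.sum_eq_single j]
  · rw [smul_dotProduct, vec, intVec_dotProduct, D.dual_gen I j hj j hj]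
    simp
  · intro i _ hij
    by_cases hi : i ∈ D.cell I
    · rw [smul_dotProduct, vec, intVec_dotProduct, D.dual_gen I i hi j hj]
      simp [hij]
    · simp [hc i hi]
  · simp

theorem linearIndepOn_cell (I : κ) : LinearIndepOn ℝ D.vec (D.cell I) := by
  rw [linearIndepOn_iff'']
  intro t g ht hg h i hi
  have hg' : ∀ i, i ∉ D.cell I → g i = 0 := fun i hi => hg i fun h => hi (ht h)
  rw [← D.sum_dotProduct_dual hg' (ht hi)]
  have : ∑ i, g i • D.vec i = 0 := by
    rw [← h]
    exact (Finset.sum_subset (Finset.subset_univ t) fun i _ hi => by simp [hg i hi]).symm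
  rw [this, zero_dotProduct]

theorem sum_dotProduct_vertex_le {c : ι → ℝ} (hc : ∀ i, 0 ≤ c i) (I : κ) :
    (∑ i, c i • D.vec i) ⬝ᵥ intVec (D.vertex I) ≤ ∑ i, c i * D.height i := by
  rw [sum_dotProduct]
  refine Finset.sum_le_sum fun i _ => ?_
  rw [smul_dotProduct, vec, intVec_dotProduct, smul_eq_mul]
  exact mul_le_mul_of_nonneg_left (by exact_mod_cast D.gen_vertex_le I i) (hc i)

theorem sum_dotProduct_vertex_eq_iff {c : ι → ℝ} (hc : ∀ i, 0 ≤ c i) (I : κ) :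
    (∑ i, c i • D.vec i) ⬝ᵥ intVec (D.vertex I) = ∑ i, c i * D.height i ↔
      ∀ i, i ∉ D.cell I → c i = 0 := by
  rw [sum_dotProduct, Finset.sum_eq_sum_iff_of_le]
  · simp only [Finset.mem_univ, forall_true_left, smul_dotProduct, vec, intVec_dotProduct,
      smul_eq_mul, mul_eq_mul_left_iff]
    refine forall_congr' fun i => ?_
    rw [← D.gen_vertex_eq_iff, Int.cast_inj]
    tauto
  · intro i _
    rw [smul_dotProduct, vec, intVec_dotProduct, smul_eq_mul]
    exact mul_le_mul_of_nonneg_left (by exact_mod_cast D.gen_vertex_le I i) (hc i)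

/-- Pairing the common vector with `vertex I` and `vertex I'` bounds each of the two height sums by
the other. They are therefore equal, and equality in the bound for `I` is possible only for
coefficients supported on `cell I`. -/
theorem supported_of_sum_eq {c d : ι → ℝ} (hc : ∀ i, 0 ≤ c i) (hd : ∀ i, 0 ≤ d i) {I I' : κ}
    (hcI : ∀ i, i ∉ D.cell I → c i = 0) (hdI : ∀ i, i ∉ D.cell I' → d i = 0)
    (h : ∑ i, c i • D.vec i = ∑ i, d i • D.vec i) : ∀ i, i ∉ D.cell I → d i = 0 := by
  rw [← D.sum_dotProduct_vertex_eq_iff hd]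
  refine le_antisymm (D.sum_dotProduct_vertex_le hd I) ?_
  rw [← (D.sum_dotProduct_vertex_eq_iff hd I').2 hdI, ← h,
    (D.sum_dotProduct_vertex_eq_iff hc I).2 hcI]
  exact D.sum_dotProduct_vertex_le hc I'

/-- Every vector has only one representation as a nonnegative combination of the generators of
some maximal cone. -/
theorem coeff_unique {c d : ι → ℝ} (hc : ∀ i, 0 ≤ c i) (hd : ∀ i, 0 ≤ d i) {I I' : κ}
    (hcI : ∀ i, i ∉ D.cell I → c i = 0) (hdI : ∀ i, i ∉ D.cell I' → d i = 0)
    (h : ∑ i, c i • D.vec i = ∑ i, d i • D.vec i) : c = d :=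
  eq_of_sum_smul_eq (D.linearIndepOn_cell I) hcI (D.supported_of_sum_eq hc hd hcI hdI h) h

theorem cone_inf_cone {K L : Set ι} {I I' : κ} (hK : K ⊆ D.cell I) (hL : L ⊆ D.cell I') :
    D.cone K ⊓ D.cone L = D.cone (K ∩ L) := by
  apply le_antisymm
  · rintro x ⟨hx, hx'⟩
    obtain ⟨c, hc, hcK, rfl⟩ := D.mem_cone_iff.1 hx
    obtain ⟨d, hd, hdL, h⟩ := D.mem_cone_iff.1 hx'
    obtain rfl := D.coeff_unique hc hd (fun i hi => hcK i fun h => hi (hK h))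
      (fun i hi => hdL i fun h => hi (hL h)) h.symm
    refine D.sum_mem_cone hc fun i hi => ?_
    by_cases h : i ∈ K
    · exact hdL i fun h' => hi ⟨h, h'⟩
    · exact hcK i h
  · exact le_inf (D.cone_mono Set.inter_subset_left) (D.cone_mono Set.inter_subset_right)

theorem isFaceOf_cone {K L : Set ι} {I : κ} (hK : K ⊆ D.cell I) (hL : L ⊆ K) :
    (D.cone L).IsFaceOf (D.cone K) :=
  isFaceOf_hull_image ((D.linearIndepOn_cell I).mono hK) hL

/-- The fan given by convex fan data. -/
def fan : PolyhedralFan n where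
  cones := {C | ∃ I, ∃ K ⊆ D.cell I, C = D.cone K}
  nonempty := by
    obtain ⟨I, -⟩ := D.cover 0
    exact ⟨_, I, _, subset_rfl, rfl⟩
  finite := (Set.finite_range D.cone).subset <| by
    rintro _ ⟨I, K, -, rfl⟩
    exact ⟨K, rfl⟩
  polyhedral := by
    rintro _ ⟨I, K, -, rfl⟩
    exact Submodule.fg_span (Set.toFinite _)
  face_mem := by
    rintro _ ⟨I, K, hK, rfl⟩ F hF
    exact ⟨I, _, (Set.sep_subset _ _).trans hK, hF.eq_hull_image⟩
  inter_face := by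
    rintro _ ⟨I, K, hK, rfl⟩ _ ⟨I', L, hL, rfl⟩
    rw [D.cone_inf_cone hK hL]
    exact ⟨D.isFaceOf_cone hK Set.inter_subset_left, D.isFaceOf_cone hL Set.inter_subset_right⟩

theorem isComplete_fan : D.fan.IsComplete := fun x => by
  obtain ⟨I, hI⟩ := D.exists_mem_cone_cell x
  exact ⟨_, ⟨I, _, subset_rfl, rfl⟩, hI⟩

theorem coneDim_cone {I : κ} {K : Set ι} (hK : K ⊆ D.cell I) :
    PolyhedralFan.coneDim (D.cone K) = K.ncard := by
  have hv := (D.linearIndepOn_cell I).mono hK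
  rw [PolyhedralFan.coneDim, cone, span_hull, ← hv.injOn.ncard_image]
  have := Fintype.ofFinite (D.vec '' K)
  rw [finrank_span_set_eq_card hv.id_image, Set.ncard_eq_toFinset_card']

theorem isPrimitive_vec (i : ι) : PolyhedralFan.IsPrimitive (D.vec i) := by
  obtain ⟨I, hI⟩ := D.exists_mem_cell i
  refine ⟨D.gen i, ?_, fun _ => rfl⟩
  have h := D.dual_gen I i hI i hI
  rw [if_pos rfl] at h
  rw [← Finset.normalize_gcd, normalize_eq_one, isUnit_iff_dvd_one, ← h]
  exact Finset.dvd_sum fun a _ => Dvd.dvd.mul_right (Finset.gcd_dvd (Finset.mem_univ a)) _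

/-- The coefficients of a lattice point are its pairings with the integral dual basis, hence
integers. -/
theorem coneMultiplicity_image {I : κ} {K : Set ι} (hK : K ⊆ D.cell I) :
    PolyhedralFan.coneMultiplicity (D.vec '' K) = 1 := by
  rw [PolyhedralFan.coneMultiplicity, AddSubgroup.relIndex_eq_one]
  rintro x ⟨⟨z, rfl⟩, hx⟩
  obtain ⟨c, hcK, h⟩ : ∃ c : ι → ℝ, (∀ i, i ∉ K → c i = 0) ∧
      ∑ i, c i • D.vec i = intVec z := by
    obtain ⟨l, hl, h⟩ := (Finsupp.mem_span_image_iff_linearCombination ℝ).1 hx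
    refine ⟨l, fun i hi => ?_, ?_⟩
    · by_contra h0
      exact hi (hl (Finsupp.mem_support_iff.2 h0))
    · rw [Finsupp.linearCombination_apply, Finsupp.sum_fintype _ _ (by simp)] at h
      exact h
  have hint : ∀ i ∈ K, c i = ((z ⬝ᵥ D.dual I i : ℤ) : ℝ) := fun i hi => by
    rw [← D.sum_dotProduct_dual (fun j hj => hcK j fun h => hj (hK h)) (hK hi), h,
      intVec_dotProduct]
  change intVec z ∈ _
  rw [← h]
  refine AddSubgroup.sum_mem _ fun i _ => ?_
  by_cases hi : i ∈ K
  · rw [hint i hi, Int.cast_smul_eq_zsmul]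
    exact AddSubgroup.zsmul_mem _ (AddSubgroup.subset_closure (Set.mem_image_of_mem _ hi)) _
  · rw [hcK i hi, zero_smul]
    exact zero_mem _

theorem isUnimodular_fan : D.fan.IsUnimodular where
  unimodularCone := by
    rintro _ ⟨I, K, hK, rfl⟩
    refine ⟨D.vec '' K, ⟨Set.toFinite _, ?_, ?_, rfl⟩, D.coneMultiplicity_image hK⟩
    · rintro _ ⟨i, -, rfl⟩
      exact D.isPrimitive_vec i
    · exact ((D.linearIndepOn_cell I).mono hK).id_image
  fullDimensional := by
    rintro _ ⟨I, K, hK, rfl⟩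
    exact ⟨_, ⟨I, _, subset_rfl, rfl⟩, D.cone_mono hK,
      (D.coneDim_cone subset_rfl).trans (D.ncard_cell I)⟩

theorem eq_of_vec_mem_cone_singleton {i j : ι} (h : D.vec i ∈ D.cone {j}) : i = j := by
  obtain ⟨c, hc, hcj, hsum⟩ := D.mem_cone_iff.1 h
  obtain ⟨I, hI⟩ := D.exists_mem_cell i
  obtain ⟨J, hJ⟩ := D.exists_mem_cell j
  have : c = Pi.single i 1 := by
    refine D.coeff_unique hc (fun k => ?_) (I := J) (I' := I) (fun k hk => hcj k ?_)
      (fun k hk => ?_) ?_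
    · by_cases h : k = i <;> simp [h]
    · rintro rfl
      exact hk hJ
    · have : k ≠ i := by
        rintro rfl
        exact hk hI
      simp [this]
    · rw [hsum]
      simp [Pi.single_apply]
  by_contra hij
  have h0 := hcj i hij
  simp [this] at h0

theorem rays_fan : D.fan.rays = Set.range fun j => D.cone {j} := by
  ext C
  constructor
  · rintro ⟨⟨I, K, hK, rfl⟩, hdim⟩
    rw [D.coneDim_cone hK, Set.ncard_eq_one] at hdim
    obtain ⟨j, rfl⟩ := hdim
    exact ⟨j, rfl⟩
  · rintro ⟨j, rfl⟩
    obtain ⟨I, hI⟩ := D.exists_mem_cell j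
    have hI' : {j} ⊆ D.cell I := Set.singleton_subset_iff.2 hI
    exact ⟨⟨I, _, hI', rfl⟩, by rw [D.coneDim_cone hI', Set.ncard_singleton]⟩

theorem ncard_rays_fan : D.fan.rays.ncard = Fintype.card ι := by
  rw [rays_fan, ← Set.image_univ, Set.ncard_image_of_injective, Set.ncard_univ,
    Nat.card_eq_fintype_card]
  intro i j h
  refine D.eq_of_vec_mem_cone_singleton ?_
  rw [← show D.cone {i} = D.cone {j} from h]
  exact D.vec_mem_cone rfl

/-! ### Polytopality -/

/-- The polytope whose normal fan is the fan of the convex fan data. -/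
def polytope : Set (Fin n → ℝ) := convexHull ℝ (Set.range fun I => intVec (D.vertex I))

theorem vertex_mem_polytope (I : κ) : intVec (D.vertex I) ∈ D.polytope :=
  subset_convexHull _ _ ⟨I, rfl⟩

theorem vec_dotProduct_le {p : Fin n → ℝ} (hp : p ∈ D.polytope) (i : ι) :
    D.vec i ⬝ᵥ p ≤ D.height i := by
  have hconv : Convex ℝ {p : Fin n → ℝ | D.vec i ⬝ᵥ p ≤ D.height i} :=
    convex_halfSpace_le ⟨fun x y => dotProduct_add _ x y, fun c x => dotProduct_smul c _ x⟩ _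
  refine convexHull_min ?_ hconv hp
  rintro _ ⟨I, rfl⟩
  change D.vec i ⬝ᵥ intVec (D.vertex I) ≤ D.height i
  rw [vec, intVec_dotProduct]
  exact_mod_cast D.gen_vertex_le I i

theorem sum_dotProduct_le {c : ι → ℝ} (hc : ∀ i, 0 ≤ c i) {p : Fin n → ℝ}
    (hp : p ∈ D.polytope) : (∑ i, c i • D.vec i) ⬝ᵥ p ≤ ∑ i, c i * D.height i := by
  rw [sum_dotProduct]
  refine Finset.sum_le_sum fun i _ => ?_
  rw [smul_dotProduct, smul_eq_mul]
  exact mul_le_mul_of_nonneg_left (D.vec_dotProduct_le hp i) (hc i)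

theorem sum_dotProduct_eq_iff {c : ι → ℝ} (hc : ∀ i, 0 ≤ c i) {p : Fin n → ℝ}
    (hp : p ∈ D.polytope) :
    (∑ i, c i • D.vec i) ⬝ᵥ p = ∑ i, c i * D.height i ↔
      ∀ i, 0 < c i → D.vec i ⬝ᵥ p = D.height i := by
  rw [sum_dotProduct, Finset.sum_eq_sum_iff_of_le]
  · simp only [Finset.mem_univ, forall_true_left, smul_dotProduct, smul_eq_mul,
      mul_eq_mul_left_iff]
    refine forall_congr' fun i => ⟨fun h hi => h.resolve_right hi.ne', fun h => ?_⟩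
    rcases (hc i).eq_or_lt with h0 | h0
    · exact Or.inr h0.symm
    · exact Or.inl (h h0)
  · intro i _
    rw [smul_dotProduct, smul_eq_mul]
    exact mul_le_mul_of_nonneg_left (D.vec_dotProduct_le hp i) (hc i)

theorem mem_faceInDirection_iff {c : ι → ℝ} (hc : ∀ i, 0 ≤ c i) {I : κ}
    (hI : ∀ i, i ∉ D.cell I → c i = 0) {p : Fin n → ℝ} :
    p ∈ PolyhedralFan.faceInDirection D.polytope (∑ i, c i • D.vec i) ↔
      p ∈ D.polytope ∧ ∀ i, 0 < c i → D.vec i ⬝ᵥ p = D.height i := by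
  refine and_congr_right fun hp => ?_
  rw [← D.sum_dotProduct_eq_iff hc hp]
  constructor
  · intro h
    have h' := h _ (D.vertex_mem_polytope I)
    rw [dotProduct_sub, (D.sum_dotProduct_vertex_eq_iff hc I).2 hI] at h'
    exact le_antisymm (D.sum_dotProduct_le hc hp) (by linarith)
  · intro h x hx
    rw [dotProduct_sub, h]
    linarith [D.sum_dotProduct_le hc hx]

theorem vertex_mem_faceInDirection_iff {c : ι → ℝ} (hc : ∀ i, 0 ≤ c i) {I J : κ}
    (hI : ∀ i, i ∉ D.cell I → c i = 0) :
    intVec (D.vertex J) ∈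
        PolyhedralFan.faceInDirection D.polytope (∑ i, c i • D.vec i) ↔
      ∀ i, 0 < c i → i ∈ D.cell J := by
  rw [D.mem_faceInDirection_iff hc hI, and_iff_right (D.vertex_mem_polytope J)]
  refine forall_congr' fun i => imp_congr_right fun _ => ?_
  rw [vec, intVec_dotProduct, Int.cast_inj, D.gen_vertex_eq_iff]

/-- The vertices of the face belong to the maximal cells containing the support of `c`. By `flip`,
these cells have no common generator outside that support. -/
theorem normalCone_faceInDirection {c : ι → ℝ} (hc : ∀ i, 0 ≤ c i) {I : κ}
    (hI : ∀ i, i ∉ D.cell I → c i = 0) :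
    PolyhedralFan.normalCone D.polytope
        (PolyhedralFan.faceInDirection D.polytope (∑ i, c i • D.vec i)) =
      D.cone {i | 0 < c i} := by
  have hcI : ∀ i, 0 < c i → i ∈ D.cell I := fun i hi => by
    by_contra h
    exact hi.ne' (hI i h)
  apply le_antisymm
  · intro b hb
    obtain ⟨J, hJ⟩ := D.exists_mem_cone_cell b
    obtain ⟨d, hd, hdJ, rfl⟩ := D.mem_cone_iff.1 hJ
    refine D.sum_mem_cone hd fun j hj => ?_
    obtain ⟨I', hI', hjI'⟩ : ∃ I', (∀ i, 0 < c i → i ∈ D.cell I') ∧ j ∉ D.cell I' := by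
      by_cases h : j ∈ D.cell I
      · obtain ⟨I', h1, h2⟩ := D.flip I j h
        refine ⟨I', fun i hi => h1 i (hcI i hi) ?_, h2⟩
        rintro rfl
        exact hj hi
      · exact ⟨I, hcI, h⟩
    -- Both vertices maximize the functional, so its coefficients `d` are supported on `cell I'`,
    -- which omits `j`.
    have h := hb _ ((D.vertex_mem_faceInDirection_iff hc hI).2 hI') _ (D.vertex_mem_polytope J)
    rw [dotProduct_sub, (D.sum_dotProduct_vertex_eq_iff hd J).2 hdJ] at h
    exact (D.sum_dotProduct_vertex_eq_iff hd I').1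
      (le_antisymm (D.sum_dotProduct_vertex_le hd I') (by linarith)) j hjI'
  · intro b hb p hp q hq
    obtain ⟨d, hd, hdc, rfl⟩ := D.mem_cone_iff.1 hb
    have hp' := (D.mem_faceInDirection_iff hc hI).1 hp
    have hpd := (D.sum_dotProduct_eq_iff hd hp'.1).2 fun i hi => hp'.2 i <| by
      by_contra h
      exact hi.ne' (hdc i h)
    rw [dotProduct_sub, hpd]
    linarith [D.sum_dotProduct_le hd hq]

theorem isPolytopal_fan [Finite κ] : D.fan.IsPolytopal := by
  obtain ⟨I, -⟩ := D.cover 0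
  have hfin := Set.finite_range fun I => intVec (D.vertex I)
  refine ⟨hfin.toFinset, ⟨intVec (D.vertex I), by simp⟩, ?_⟩
  rw [hfin.coe_toFinset]
  change _ = PolyhedralFan.normalFanCones D.polytope
  ext C
  constructor
  · rintro ⟨I, K, hK, rfl⟩
    classical
    have hc : ∀ i, 0 ≤ (if i ∈ K then (1 : ℝ) else 0) := fun i => by split_ifs <;> simp
    -- The sum of the generators is a direction in the relative interior of the cone.
    refine ⟨∑ i, (if i ∈ K then (1 : ℝ) else 0) • D.vec i, ?_⟩
    rw [D.normalCone_faceInDirection hc (I := I) fun i hi => if_neg fun h => hi (hK h)]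
    congr 1
    ext i
    by_cases h : i ∈ K <;> simp [h]
  · rintro ⟨a, rfl⟩
    obtain ⟨I, hI⟩ := D.exists_mem_cone_cell a
    obtain ⟨c, hc, hcI, rfl⟩ := D.mem_cone_iff.1 hI
    refine ⟨I, _, fun i hi => ?_, D.normalCone_faceInDirection hc hcI⟩
    by_contra h
    exact hi.ne' (hcI i h)

/-! ### Coarsenings -/

section Coarsening

variable {𝒩 : PolyhedralFan n} (href : D.fan.Refines 𝒩) (huni : 𝒩.IsUnimodular)

include href in
theorem exists_cone_cell_le (I : κ) : ∃ C ∈ 𝒩.cones, D.cone (D.cell I) ≤ C :=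
  href _ ⟨I, _, subset_rfl, rfl⟩

include href in
/-- Every ray of a coarsening is spanned by one of the ray generators. -/
theorem exists_eq_smul_vec {w : Fin n → ℝ} (hw : w ≠ 0) (hray : hull ℝ {w} ∈ 𝒩.cones) :
    ∃ i, ∃ r : ℝ, 0 < r ∧ D.vec i = r • w := by
  obtain ⟨I, hI⟩ := D.exists_mem_cone_cell w
  obtain ⟨C, hC, hIC⟩ := D.exists_cone_cell_le href I
  obtain ⟨c, hc, hcI, hsum⟩ := D.mem_cone_iff.1 hI
  obtain ⟨i, hi⟩ : ∃ i, 0 < c i := by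
    by_contra! h
    exact hw (by rw [← hsum]; simp [fun i => le_antisymm (h i) (hc i)])
  -- The ray is a face of `C` along which `w` splits into generators of a cell, so these generators
  -- lie on it.
  have hmem : D.vec i ∈ hull ℝ {w} ⊓ C := by
    refine mem_of_sum_mem_of_isFaceOf (𝒩.inter_face _ hray _ hC).2 hc (fun j hj => ?_) ?_ hi
    · refine hIC (D.vec_mem_cone ?_)
      by_contra h
      exact hj.ne' (hcI j h)
    · rw [hsum]
      exact ⟨subset_hull (Set.mem_singleton w), hIC hI⟩
  obtain ⟨r, hr, h⟩ := mem_hull_singleton_iff.1 hmem.1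
  refine ⟨i, r, hr.lt_of_ne ?_, h⟩
  rintro rfl
  obtain ⟨J, hJ⟩ := D.exists_mem_cell i
  exact (D.linearIndepOn_cell J).ne_zero hJ (by simpa using h)

include href huni in
/-- The cones of a unimodular coarsening are generated by those ray generators that span rays of
the coarsening. -/
theorem exists_eq_cone {C : PointedCone ℝ (Fin n → ℝ)} (hC : C ∈ 𝒩.cones) :
    ∃ S : Set ι, C = D.cone S ∧ LinearIndepOn ℝ D.vec S ∧ ∀ i ∈ S, D.cone {i} ∈ 𝒩.cones := by
  obtain ⟨s, ⟨hfin, -, hli, hhull⟩, -⟩ := huni.unimodularCone C hC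
  have := hfin.fintype
  have hli' : LinearIndependent ℝ ((↑) : s → Fin n → ℝ) := hli
  have hC' : C = hull ℝ (((↑) : s → Fin n → ℝ) '' Set.univ) := by simp [hhull]
  have hray : ∀ w : s, hull ℝ {(w : Fin n → ℝ)} ∈ 𝒩.cones := fun w => by
    refine 𝒩.face_mem C hC _ ?_
    rw [hC', ← Set.image_singleton]
    exact isFaceOf_hull_image (linearIndepOn_univ_iff.2 hli') (Set.subset_univ _)
  choose f r hr hf using fun w : s => D.exists_eq_smul_vec href (hli'.ne_zero w) (hray w)
  have hli'' : LinearIndependent ℝ (D.vec ∘ f) := by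
    have := hli'.units_smul fun w => Units.mk0 (r w) (hr w).ne'
    convert this using 1
    funext w
    exact hf w
  refine ⟨Set.range f, le_antisymm ?_ ?_, ?_, ?_⟩
  · rw [← hhull]
    refine Submodule.span_le.2 fun w hw => ?_
    refine mem_of_smul_mem (hr ⟨w, hw⟩) ?_
    rw [← hf ⟨w, hw⟩]
    exact D.vec_mem_cone ⟨_, rfl⟩
  · rw [cone_le_iff]
    rintro _ ⟨w, rfl⟩
    rw [hf w, ← hhull]
    exact (hull ℝ s).smul_mem (hr w).le (subset_hull w.2)
  · exact (linearIndepOn_range_iff (fun a b h => hli''.injective (congrArg D.vec h)) D.vec).2 hli''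
  · rintro _ ⟨w, rfl⟩
    rw [cone, Set.image_singleton, hf w, hull_singleton_smul (hr w)]
    exact hray w

include href huni in
/-- A ray generator that does not span a ray of a unimodular coarsening lies in the relative
interior of a cone of the coarsening; the generators of this cone share a cone of the coarsening
with every maximal cone containing the given ray generator. -/
theorem exists_positive_combination {j : ι} (hj : D.cone {j} ∉ 𝒩.cones) :
    ∃ c : ι → ℝ, (∀ i, 0 ≤ c i) ∧ c j = 0 ∧ ∑ i, c i • D.vec i = D.vec j ∧
      LinearIndepOn ℝ D.vec {i | 0 < c i} ∧
      ∀ I, j ∈ D.cell I → ∃ C ∈ 𝒩.cones, D.cone (D.cell I) ≤ C ∧ ∀ i, 0 < c i → D.vec i ∈ C := by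
  obtain ⟨I₀, hI₀⟩ := D.exists_mem_cell j
  obtain ⟨C₀, hC₀, hle⟩ := D.exists_cone_cell_le href I₀
  obtain ⟨S, rfl, hli, hS⟩ := D.exists_eq_cone href huni hC₀
  obtain ⟨c, hc, hcS, hsum⟩ := D.mem_cone_iff.1 (hle (D.vec_mem_cone hI₀))
  have hcS' : ∀ i, 0 < c i → i ∈ S := fun i hi => by
    by_contra h
    exact hi.ne' (hcS i h)
  refine ⟨c, hc, hcS j fun h => hj (hS j h), hsum, hli.mono hcS', fun I hI => ?_⟩
  obtain ⟨C, hC, hIC⟩ := D.exists_cone_cell_le href I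
  refine ⟨C, hC, hIC, fun i hi => ?_⟩
  -- The common face of the two cones contains `D.vec j`, hence every generator occurring in it with
  -- positive coefficient.
  refine (mem_of_sum_mem_of_isFaceOf (F := D.cone S ⊓ C) (𝒩.inter_face _ hC₀ _ hC).1 hc
    (fun i hi => D.vec_mem_cone (hcS' i hi)) ?_ hi).2
  rw [hsum]
  exact ⟨hle (D.vec_mem_cone hI₀), hIC (D.vec_mem_cone hI)⟩

include href huni in
theorem eq_zero_of_mem_cone {C : PointedCone ℝ (Fin n → ℝ)} (hC : C ∈ 𝒩.cones) {x : Fin n → ℝ}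
    (hx : x ∈ C) (hx' : -x ∈ C) : x = 0 := by
  obtain ⟨S, rfl, hli, -⟩ := D.exists_eq_cone href huni hC
  exact eq_zero_of_mem_of_neg_mem hli hx hx'

theorem vec_ne_zero (i : ι) : D.vec i ≠ 0 := by
  obtain ⟨J, hJ⟩ := D.exists_mem_cell i
  exact (D.linearIndepOn_cell J).ne_zero hJ

include href huni in
/-- If a ray generator does not span a ray of a unimodular coarsening, then it is a positive
combination of independent ray generators. Their negatives are not adjacent to it, and their span
does not contain any of its neighbours whose negative is also a neighbour. -/
theorem exists_positive_combination_of_not_mem {j : ι} (hj : D.cone {j} ∉ 𝒩.cones) :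
    ∃ c : ι → ℝ, (∀ i, 0 ≤ c i) ∧ c j = 0 ∧ ∑ i, c i • D.vec i = D.vec j ∧
      LinearIndepOn ℝ D.vec {i | 0 < c i} ∧
      (∀ I, j ∈ D.cell I → ∀ i ∈ D.cell I, ∀ i', D.vec i' = -D.vec i → c i' = 0) ∧
      ∀ I I', j ∈ D.cell I → j ∈ D.cell I' → ∀ i ∈ D.cell I, ∀ i' ∈ D.cell I',
        D.vec i' = -D.vec i → D.vec i ∉ Submodule.span ℝ (D.vec '' {i | 0 < c i}) := by
  obtain ⟨c, hc, hcj, hsum, hli, hstar⟩ := D.exists_positive_combination href huni hj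
  refine ⟨c, hc, hcj, hsum, hli, ?_, ?_⟩
  · intro I hI i hi i' hneg
    by_contra h
    obtain ⟨C, hC, hIC, hcC⟩ := hstar I hI
    refine D.vec_ne_zero i (D.eq_zero_of_mem_cone href huni hC (hIC (D.vec_mem_cone hi)) ?_)
    rw [← hneg]
    exact hcC i' (lt_of_le_of_ne (hc i') (Ne.symm h))
  · intro I I' hI hI' i hi i' hi' hneg hspan
    obtain ⟨C, hC, hIC, hcC⟩ := hstar I hI
    obtain ⟨C', hC', hIC', hcC'⟩ := hstar I' hI'
    obtain ⟨e, he, hesum⟩ := (Finsupp.mem_span_image_iff_linearCombination ℝ).1 hspan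
    rw [Finsupp.linearCombination_apply, Finsupp.sum_fintype _ _ (by simp)] at hesum
    have he' : ∀ k, ¬ 0 < c k → e k = 0 := fun k hk => by
      by_contra h
      exact hk (he (Finsupp.mem_support_iff.2 h))
    -- Positive coefficients stay nonnegative under a small perturbation, so one may move from
    -- `D.vec j` slightly against `D.vec i` without leaving `C`.
    obtain ⟨t, ht, htc⟩ : ∃ t : ℝ, 0 < t ∧ ∀ k, 0 ≤ c k - t * e k := by
      have hev : ∀ᶠ t in nhdsWithin (0 : ℝ) (Set.Ioi 0), ∀ k, 0 ≤ c k - t * e k := by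
        rw [Filter.eventually_all]
        intro k
        by_cases hk : 0 < c k
        · have hcont : Filter.Tendsto (fun t : ℝ => c k - t * e k) (nhdsWithin 0 (Set.Ioi 0))
              (nhds (c k - 0 * e k)) :=
            (Continuous.tendsto (by fun_prop) 0).mono_left nhdsWithin_le_nhds
          rw [zero_mul, sub_zero] at hcont
          filter_upwards [hcont.eventually (lt_mem_nhds hk)] with t ht using ht.le
        · filter_upwards with t
          simp [he' k hk, hc k]
      obtain ⟨t, h, ht⟩ := (hev.and self_mem_nhdsWithin).exists
      exact ⟨t, ht, h⟩
    have hy : D.vec j - t • D.vec i ∈ C := by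
      have : D.vec j - t • D.vec i = ∑ k, (c k - t * e k) • D.vec k := by
        simp only [sub_smul, Finset.sum_sub_distrib, mul_smul, ← Finset.smul_sum, hsum, hesum]
      rw [this]
      refine Submodule.sum_mem _ fun k _ => ?_
      by_cases hk : 0 < c k
      · exact C.smul_mem (htc k) (hcC k hk)
      · have : c k = 0 := le_antisymm (not_lt.1 hk) (hc k)
        simp [this, he' k hk]
    have hiC : D.vec i ∈ C := hIC (D.vec_mem_cone hi)
    -- `D.vec j` lies in the common face and splits as `t • D.vec i` plus a vector of `C`. Hence
    -- `D.vec i` lies in `C'`, which also contains its negative.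
    have hmem : D.vec i ∈ C ⊓ C' := by
      refine (𝒩.inter_face _ hC _ hC').1.mem_of_smul_add_mem hiC hy ht ?_
      rw [add_sub_cancel]
      exact ⟨hIC (D.vec_mem_cone hI), hIC' (D.vec_mem_cone hI')⟩
    refine D.vec_ne_zero i (D.eq_zero_of_mem_cone href huni hC' hmem.2 ?_)
    rw [← hneg]
    exact hIC' (D.vec_mem_cone hi')

include href huni in
/-- A unimodular coarsening with the same rays is equal to the fan. -/
theorem fan_eq_of_cone_singleton_mem (hrays : ∀ j, D.cone {j} ∈ 𝒩.cones) : D.fan = 𝒩 := by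
  have hcell : ∀ I, D.cone (D.cell I) ∈ 𝒩.cones := fun I => by
    obtain ⟨C, hC, hIC⟩ := D.exists_cone_cell_le href I
    obtain ⟨S, rfl, hli, -⟩ := D.exists_eq_cone href huni hC
    -- Each ray of the cell is a ray of `𝒩` inside `C`, thus a face of `C` spanned by a member of
    -- `S`. Independence then bounds `S` by `n`, the size of the cell.
    have hsub : D.cell I ⊆ S := fun i hi => by
      have hface : (D.cone {i}).IsFaceOf (hull ℝ (D.vec '' S)) := by
        have := (𝒩.inter_face _ (hrays i) _ hC).2
        rwa [inf_eq_left.2] at this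
        rw [cone_le_iff]
        rintro _ rfl
        exact hIC (D.vec_mem_cone hi)
      have hne : ({k ∈ S | D.vec k ∈ D.cone {i}}).Nonempty := by
        rw [Set.nonempty_iff_ne_empty]
        intro h
        have h' := hface.eq_hull_image
        have hmem := D.vec_mem_cone (Set.mem_singleton i)
        rw [h', h] at hmem
        exact D.vec_ne_zero i (by simpa using hmem)
      obtain ⟨k, hk, hki⟩ := hne
      rwa [← D.eq_of_vec_mem_cone_singleton hki]
    have hcard : S.ncard ≤ n := by
      have h := hli.encard_le_toENat_rank
      rw [rank_fin_fun, ← (Set.toFinite S).cast_ncard_eq, Cardinal.toENat_nat] at h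
      exact_mod_cast h
    rwa [Set.eq_of_subset_of_ncard_le hsub (by rwa [D.ncard_cell I])]
  have hsub : D.fan.cones ⊆ 𝒩.cones := by
    rintro _ ⟨I, K, hK, rfl⟩
    exact 𝒩.face_mem _ (hcell I) _ (D.isFaceOf_cone subset_rfl hK)
  refine PolyhedralFan.ext (hsub.antisymm fun C hC => ?_)
  obtain ⟨S, rfl, -, -⟩ := D.exists_eq_cone href huni hC
  classical
  let c : ι → ℝ := fun i => if i ∈ S then 1 else 0
  have hc : ∀ i, 0 ≤ c i := fun i => by simp only [c]; split_ifs <;> simp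
  have hcS : ∀ i, i ∉ S → c i = 0 := fun i hi => if_neg hi
  -- The cell containing an interior point of `D.cone S` contains all of it, because the two cones
  -- meet in a face.
  obtain ⟨I, hI⟩ := D.exists_mem_cone_cell (∑ i, c i • D.vec i)
  have hface := 𝒩.inter_face _ hC _ (hcell I)
  have hle : D.cone S ≤ D.cone (D.cell I) := by
    rw [cone_le_iff]
    intro i hi
    refine (mem_of_sum_mem_of_isFaceOf hface.1 hc (fun k hk => D.vec_mem_cone ?_)
      ⟨D.sum_mem_cone hc hcS, hI⟩ (?_ : 0 < c i)).2
    · by_contra h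
      exact hk.ne' (hcS k h)
    · simp [c, hi]
  rw [inf_eq_left.2 hle] at hface
  exact D.fan.face_mem _ ⟨I, _, subset_rfl, rfl⟩ _ hface.2

end Coarsening

end ConvexFanData

/-! ### The suspended cycle over the parabola -/

namespace SlopeFan

/-- The rays spanned by `(0, 0, ±1)`, `(0, ±1, 0)` and `(-1, 0, 0)`. -/
inductive Pole
  | up | down | north | south | west
  deriving DecidableEq

instance : Fintype Pole := ⟨{.up, .down, .north, .south, .west}, by rintro ⟨⟩ <;> decide⟩

/-- The corners of the cycle of rays around `(0, 0, 1)`. -/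
inductive Corner
  | southEast | northEast | northWest | southWest
  deriving DecidableEq

instance : Fintype Corner :=
  ⟨{.southEast, .northEast, .northWest, .southWest}, by rintro ⟨⟩ <;> decide⟩

/-- The rays of the fan; `Sum.inl j` stands for the ray spanned by `(1, j, j ^ 2)`. -/
abbrev Ray (k : ℕ) := Fin (k + 1) ⊕ Pole

/-- The pairs of consecutive rays in the cycle around `(0, 0, 1)`. -/
abbrev Edge (k : ℕ) := Fin k ⊕ Corner

open Pole Corner

variable {k : ℕ}

/-- The primitive generators of the rays. -/
def gen : Ray k → Fin 3 → ℤ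
  | .inl j => ![1, j, j ^ 2]
  | .inr up => ![0, 0, 1]
  | .inr down => ![0, 0, -1]
  | .inr north => ![0, 1, 0]
  | .inr south => ![0, -1, 0]
  | .inr west => ![-1, 0, 0]

/-- The first ray of an edge. -/
def first : Edge k → Ray k
  | .inl i => .inl i.castSucc
  | .inr southEast => .inr south
  | .inr northEast => .inl (Fin.last k)
  | .inr northWest => .inr north
  | .inr southWest => .inr west

/-- The second ray of an edge. -/
def second : Edge k → Ray k
  | .inl i => .inl i.succ
  | .inr southEast => .inl 0
  | .inr northEast => .inr north
  | .inr northWest => .inr west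
  | .inr southWest => .inr south

/-- The ray `(0, 0, 1)` or `(0, 0, -1)`. -/
def pole : Bool → Ray k
  | true => .inr up
  | false => .inr down

/-- The sign of the third coordinate of `pole b`. -/
def sign : Bool → ℤ
  | true => 1
  | false => -1

/-- The generators of a maximal cone. -/
def cell (I : Bool × Edge k) : Set (Ray k) := {pole I.1, first I.2, second I.2}

/-- The basis dual to the generators of a maximal cone. -/
def dual (I : Bool × Edge k) (j : Ray k) : Fin 3 → ℤ :=
  let u := gen (first I.2)
  let w := gen (second I.2)
  if j = first I.2 then ![w 1, -w 0, 0]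
  else if j = second I.2 then ![-u 1, u 0, 0]
  else ![sign I.1 * (w 2 * u 1 - u 2 * w 1), sign I.1 * (u 2 * w 0 - w 2 * u 0), sign I.1]

/-- The values of the support function at the ray generators. -/
def height : Ray k → ℤ
  | .inl j => 2 * j ^ 2
  | .inr up => 1
  | .inr down => 0
  -- This exceeds the second coordinate, at most `4 * k - 2`, of every vertex of an edge between two
  -- slopes.
  | .inr north => 4 * k + 1
  | .inr south => 0
  | .inr west => 4 * k ^ 2 + k + 1

/-- The linear functions that give the support function on the maximal cones. -/
def vertex : Bool × Edge k → Fin 3 → ℤ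
  | (b, s) =>
    -- The third coordinate is forced by the height of the pole: 1 above, 0 below.
    let t : ℤ := if b then 1 else 0
    match s with
    | .inl i => ![-(2 - t) * (i ^ 2 + i), (2 - t) * (2 * i + 1), t]
    | .inr southEast => ![0, 0, t]
    | .inr northEast => ![(2 - t) * k ^ 2 - k * (4 * k + 1), 4 * k + 1, t]
    | .inr northWest => ![-(4 * k ^ 2 + k + 1), 4 * k + 1, t]
    | .inr southWest => ![-(4 * k ^ 2 + k + 1), 0, t]

theorem gen_pole (b : Bool) : gen (pole b : Ray k) = ![0, 0, sign b] := by
  cases b <;> rfl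

theorem sign_mul_self (b : Bool) : sign b * sign b = 1 := by
  cases b <;> rfl

theorem det_edge (s : Edge k) :
    gen (first s) 0 * gen (second s) 1 - gen (second s) 0 * gen (first s) 1 = 1 := by
  rcases s with i | c
  · simp [first, second, gen]
  · cases c <;> simp [first, second, gen]

theorem first_ne_second (s : Edge k) : first s ≠ second s := by
  rcases s with i | c
  · simp [first, second, Fin.ext_iff]
  · cases c <;> simp [first, second]

theorem pole_ne_first (b : Bool) (s : Edge k) : pole b ≠ first s := by
  rcases s with i | c
  · cases b <;> simp [pole, first]
  · cases b <;> cases c <;> simp [pole, first]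

theorem pole_ne_second (b : Bool) (s : Edge k) : pole b ≠ second s := by
  rcases s with i | c
  · cases b <;> simp [pole, second]
  · cases b <;> cases c <;> simp [pole, second]

theorem dual_gen (I : Bool × Edge k) {i j : Ray k} (hi : i ∈ cell I) (hj : j ∈ cell I) :
    gen i ⬝ᵥ dual I j = if i = j then 1 else 0 := by
  obtain ⟨b, s⟩ := I
  have hdet := det_edge s
  have hsign := sign_mul_self b
  have h1 := first_ne_second s
  have h2 := pole_ne_first b s
  have h3 := pole_ne_second b s
  rcases hi with rfl | rfl | rfl <;> rcases hj with rfl | rfl | rfl <;>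
    simp only [dual, dotProduct, Fin.sum_univ_three, h1, h1.symm, h2, h2.symm, h3, h3.symm,
      if_true, if_false, gen_pole, Matrix.cons_val]
  · linear_combination hsign
  · ring
  · ring
  · linear_combination -(sign b * gen (first s) 2) * hdet
  · linear_combination hdet
  · ring
  · linear_combination -(sign b * gen (second s) 2) * hdet
  · ring
  · linear_combination hdet

theorem ncard_cell (I : Bool × Edge k) : (cell I).ncard = 3 :=
  Set.ncard_eq_three.2 ⟨_, _, _, pole_ne_first _ _, pole_ne_second _ _, first_ne_second _, rfl⟩

theorem exists_edge_of_slope (j : Fin (k + 1)) :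
    ∃ s : Edge k, .inl j = first s := by
  induction j using Fin.lastCases with
  | last => exact ⟨.inr northEast, rfl⟩
  | cast i => exact ⟨.inl i, rfl⟩

theorem exists_edge_of_slope' (j : Fin (k + 1)) :
    ∃ s : Edge k, .inl j = second s := by
  induction j using Fin.cases with
  | zero => exact ⟨.inr southEast, rfl⟩
  | succ i => exact ⟨.inl i, rfl⟩

theorem exists_mem_cell (j : Ray k) : ∃ I : Bool × Edge k, j ∈ cell I := by
  rcases j with j | p
  · obtain ⟨s, hs⟩ := exists_edge_of_slope j
    exact ⟨(true, s), .inr (.inl hs)⟩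
  · cases p
    · exact ⟨(true, .inr northEast), .inl rfl⟩
    · exact ⟨(false, .inr northEast), .inl rfl⟩
    · exact ⟨(true, .inr northEast), .inr (.inr rfl)⟩
    · exact ⟨(true, .inr southEast), .inr (.inl rfl)⟩
    · exact ⟨(true, .inr southWest), .inr (.inl rfl)⟩

/-- Reversing an edge would change the sign of its determinant, which is always 1. -/
theorem not_reversed (s s' : Edge k) (h : second s = first s') (h' : first s = second s') :
    False := by
  have hdet := det_edge s
  have hdet' := det_edge s'
  rw [← h, ← h'] at hdet'
  omega

theorem exists_edge_first_eq_second (s : Edge k) : ∃ s' : Edge k, first s' = second s := by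
  rcases s with i | c
  · exact (exists_edge_of_slope i.succ).imp fun _ h => h.symm
  · cases c
    · exact (exists_edge_of_slope 0).imp fun _ h => h.symm
    · exact ⟨.inr northWest, rfl⟩
    · exact ⟨.inr southWest, rfl⟩
    · exact ⟨.inr southEast, rfl⟩

theorem exists_edge_second_eq_first (s : Edge k) : ∃ s' : Edge k, second s' = first s := by
  rcases s with i | c
  · exact (exists_edge_of_slope' i.castSucc).imp fun _ h => h.symm
  · cases c
    · exact ⟨.inr southWest, rfl⟩
    · exact (exists_edge_of_slope' (Fin.last k)).imp fun _ h => h.symm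
    · exact ⟨.inr northEast, rfl⟩
    · exact ⟨.inr northWest, rfl⟩

/-- A pole is exchanged for the opposite pole, an end of an edge by passing to the next edge of the
cycle. -/
theorem flip (I : Bool × Edge k) {j : Ray k} (hj : j ∈ cell I) :
    ∃ I', (∀ i ∈ cell I, i ≠ j → i ∈ cell I') ∧ j ∉ cell I' := by
  obtain ⟨b, s⟩ := I
  have h1 := first_ne_second s
  rcases hj with rfl | rfl | rfl
  · refine ⟨(!b, s), fun i hi hne => ?_, ?_⟩
    · rcases hi with rfl | rfl | rfl
      · exact absurd rfl hne
      · exact .inr (.inl rfl)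
      · exact .inr (.inr rfl)
    · rintro (h | h | h)
      · cases b <;> simp [pole] at h
      · exact pole_ne_first b s h
      · exact pole_ne_second b s h
  · obtain ⟨s', hs'⟩ := exists_edge_first_eq_second s
    refine ⟨(b, s'), fun i hi hne => ?_, ?_⟩
    · rcases hi with rfl | rfl | rfl
      · exact .inl rfl
      · exact absurd rfl hne
      · exact .inr (.inl hs'.symm)
    · rintro (h | h | h)
      · exact pole_ne_first b s h.symm
      · exact h1 (h.trans hs')
      · exact not_reversed s s' hs'.symm h
  · obtain ⟨s', hs'⟩ := exists_edge_second_eq_first s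
    refine ⟨(b, s'), fun i hi hne => ?_, ?_⟩
    · rcases hi with rfl | rfl | rfl
      · exact .inl rfl
      · exact .inr (.inr hs'.symm)
      · exact absurd rfl hne
    · rintro (h | h | h)
      · exact pole_ne_second b s h.symm
      · exact not_reversed s s' h hs'.symm
      · exact h1 (h.trans hs').symm

/-- The projections of the edges along the third coordinate cover the plane. -/
theorem exists_edge_of_plane (k : ℕ) (x y : ℝ) : ∃ s : Edge k,
    0 ≤ (gen (second s) 1 : ℝ) * x - gen (second s) 0 * y ∧
      0 ≤ (gen (first s) 0 : ℝ) * y - gen (first s) 1 * x := by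
  rcases le_total x 0 with hx | hx
  · rcases le_total y 0 with hy | hy
    · exact ⟨.inr southWest, by simp [first, second, gen, hx, hy]⟩
    · exact ⟨.inr northWest, by simp [first, second, gen, hx, hy]⟩
  rcases le_total y 0 with hy | hy
  · exact ⟨.inr southEast, by simp [first, second, gen, hx, hy]⟩
  by_cases hk : k * x ≤ y
  · exact ⟨.inr northEast, by simp [first, second, gen, hx, hk]⟩
  push Not at hk
  have hx' : 0 < x := by
    rcases hx.eq_or_lt with rfl | h
    · simp at hk
      linarith
    · exact h
  -- In the remaining sector the integer part of the slope selects the edge.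
  have hlt : ⌊y / x⌋₊ < k := by
    rw [Nat.floor_lt (by positivity), div_lt_iff₀ hx']
    exact hk
  have h1 := Nat.floor_le (div_nonneg hy hx)
  have h2 := Nat.lt_floor_add_one (y / x)
  rw [le_div_iff₀ hx'] at h1
  rw [div_lt_iff₀ hx'] at h2
  refine ⟨.inl ⟨_, hlt⟩, ?_, ?_⟩
  · simp [second, gen]
    linarith
  · simp [first, gen]
    linarith

theorem cover (x : Fin 3 → ℝ) :
    ∃ I : Bool × Edge k, x ∈ hull ℝ ((fun i => intVec (gen i)) '' cell I) := by
  obtain ⟨s, h1, h2⟩ := exists_edge_of_plane k (x 0) (x 1)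
  -- `p` and `q` are the coordinates of the projection in the edge basis; the sign of the vertical
  -- remainder `r` chooses the pole.
  set p : ℝ := (gen (second s) 1 : ℝ) * x 0 - gen (second s) 0 * x 1 with hp
  set q : ℝ := (gen (first s) 0 : ℝ) * x 1 - gen (first s) 1 * x 0 with hq
  set r : ℝ := x 2 - p * gen (first s) 2 - q * gen (second s) 2 with hr
  obtain ⟨b, hb⟩ : ∃ b, 0 ≤ (sign b : ℝ) * r := by
    rcases le_total 0 r with h | h
    · exact ⟨true, by simpa [sign] using h⟩
    · exact ⟨false, by simpa [sign] using h⟩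
  refine ⟨(b, s), ?_⟩
  have hx : x = p • intVec (gen (first s)) + q • intVec (gen (second s)) +
      ((sign b : ℝ) * r) • intVec (gen (pole b : Ray k)) := by
    have hdet : (gen (first s) 0 : ℝ) * gen (second s) 1 -
        gen (second s) 0 * gen (first s) 1 = 1 := by
      exact_mod_cast det_edge s
    have hsign : (sign b : ℝ) * sign b = 1 := by exact_mod_cast sign_mul_self b
    funext a
    fin_cases a
    · simp [intVec, gen_pole]
      linear_combination (-(x 0)) * hdet
    · simp [intVec, gen_pole]
      linear_combination (-(x 1)) * hdet
    · simp [intVec, gen_pole]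
      linear_combination (-r) * hsign
  rw [hx]
  have hmem : ∀ i ∈ cell (b, s), intVec (gen i) ∈
      hull ℝ ((fun i : Ray k => intVec (gen i)) '' cell (b, s)) :=
    fun i hi => subset_hull ⟨i, hi, rfl⟩
  refine add_mem (add_mem ?_ ?_) ?_
  · exact PointedCone.smul_mem _ h1 (hmem _ (.inr (.inl rfl)))
  · exact PointedCone.smul_mem _ h2 (hmem _ (.inr (.inr rfl)))
  · exact PointedCone.smul_mem _ hb (hmem _ (.inl rfl))

theorem gen_vertex (I : Bool × Edge k) (j : Ray k) :
    (j ∈ cell I ∧ gen j ⬝ᵥ vertex I = height j) ∨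
      (j ∉ cell I ∧ gen j ⬝ᵥ vertex I < height j) := by
  obtain ⟨b, i | c⟩ := I
  · have hi : (i : ℤ) + 1 ≤ k := by exact_mod_cast i.2
    have hi0 : (0 : ℤ) ≤ i := by positivity
    have hmem : ∀ l : Fin (k + 1), (.inl l : Ray k) ∈ cell (b, .inl i) ↔
        (l : ℕ) = i ∨ (l : ℕ) = i + 1 := fun l => by
      cases b <;> simp [cell, pole, first, second, Fin.ext_iff]
    rcases j with l | p
    · rw [hmem]
      obtain ⟨t, ht, hv⟩ : ∃ t : ℤ, (t = 0 ∨ t = 1) ∧ vertex (b, (.inl i : Edge k)) =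
          ![-(2 - t) * (i ^ 2 + i), (2 - t) * (2 * i + 1), t] := by
        cases b
        · exact ⟨0, .inl rfl, rfl⟩
        · exact ⟨1, .inr rfl, rfl⟩
      -- The linear function interpolates `2 * l ^ 2` at `i` and `i + 1`. The pole accounts for `t *
      -- l ^ 2`, leaving a quadratic gap with positive factor `2 - t`.
      have hval : gen (.inl l : Ray k) ⬝ᵥ vertex (b, .inl i) =
          height (.inl l : Ray k) - (2 - t) * ((l - i) * (l - (i + 1))) := by
        rw [hv]
        simp [gen, height, dotProduct, Fin.sum_univ_three]
        ring
      rw [hval]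
      have ht' : 0 < 2 - t := by omega
      rcases lt_trichotomy (l : ℕ) i with h | h | h
      · right
        refine ⟨by omega, ?_⟩
        have h' : (l : ℤ) < i := by exact_mod_cast h
        have := mul_pos ht' (mul_pos_of_neg_of_neg (sub_neg.2 h')
          (by linarith : (l : ℤ) - (i + 1) < 0))
        linarith
      · left
        exact ⟨.inl h, by rw [h]; ring⟩
      · rcases (Nat.succ_le_of_lt h).eq_or_lt with h | h
        · left
          refine ⟨.inr h.symm, ?_⟩
          rw [← h]
          push_cast
          ring
        · right
          refine ⟨by omega, ?_⟩
          have h' : (i : ℤ) + 1 < l := by exact_mod_cast h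
          have := mul_pos ht' (mul_pos (by linarith : (0 : ℤ) < l - i)
            (by linarith : (0 : ℤ) < l - (i + 1)))
          linarith
    · cases b <;> cases p <;>
        simp [cell, pole, first, second, gen, vertex, height, dotProduct, Fin.sum_univ_three] <;>
        nlinarith
  · have hk0 : (0 : ℤ) ≤ k := by positivity
    rcases j with l | p
    · have hl : (l : ℤ) ≤ k := by exact_mod_cast l.is_le
      have hl0 : (0 : ℤ) ≤ l := by positivity
      cases c
      · rcases eq_or_ne l 0 with rfl | h
        · left
          cases b <;> simp [cell, pole, first, second, gen, vertex, height, dotProduct,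
            Fin.sum_univ_three]
        · right
          have : (0 : ℤ) < l := by exact_mod_cast Fin.pos_iff_ne_zero.2 h
          cases b <;> simp [cell, pole, first, second, gen, vertex, height, dotProduct,
            Fin.sum_univ_three, h]
          · positivity
          · nlinarith
      · rcases eq_or_ne l (Fin.last k) with rfl | h
        · left
          cases b <;> simp [cell, pole, first, second, gen, vertex, height, dotProduct,
            Fin.sum_univ_three]
          ring
        · right
          have : (l : ℤ) < k := by exact_mod_cast Fin.lt_last_iff_ne_last.2 h
          cases b <;> simp [cell, pole, first, second, gen, vertex, height, dotProduct,
            Fin.sum_univ_three, h] <;> nlinarith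
      · right
        cases b <;> simp [cell, pole, first, second, gen, vertex, height, dotProduct,
          Fin.sum_univ_three] <;> nlinarith
      · right
        cases b <;> simp [cell, pole, first, second, gen, vertex, height, dotProduct,
          Fin.sum_univ_three] <;> nlinarith
    · cases b <;> cases c <;> cases p <;>
        simp [cell, pole, first, second, gen, vertex, height, dotProduct, Fin.sum_univ_three] <;>
        nlinarith

/-- The fan with rays spanned by `(1, j, j ^ 2)` for `j ≤ k`, `(0, 0, ±1)`, `(0, ±1, 0)` and
`(-1, 0, 0)`. -/
def data (k : ℕ) : ConvexFanData 3 (Ray k) (Bool × Edge k) where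
  gen := gen
  cell := cell
  dual := dual
  height := height
  vertex := vertex
  dual_gen I _ hi _ hj := dual_gen I hi hj
  gen_vertex_le I j := (gen_vertex I j).elim (fun h => h.2.le) fun h => h.2.le
  gen_vertex_eq_iff I j := by
    rcases gen_vertex I j with h | h
    · exact iff_of_true h.2 h.1
    · exact iff_of_false h.2.ne h.1
  flip I _ hj := flip I hj
  cover := cover
  ncard_cell := ncard_cell
  exists_mem_cell := exists_mem_cell

theorem card_ray (k : ℕ) : Fintype.card (Ray k) = k + 6 := by
  have h : Fintype.card Pole = 5 := rfl
  rw [Fintype.card_sum, Fintype.card_fin, h]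

/-! ### Every ray survives in a unimodular coarsening -/

theorem sum_pole (f : Pole → ℝ) : ∑ p, f p = f up + f down + f north + f south + f west := by
  have : (Finset.univ : Finset Pole) = {up, down, north, south, west} := rfl
  rw [this]
  simp [add_assoc]

theorem coords_of_sum_eq {c : Ray k → ℝ} {j : Ray k}
    (h : ∑ i, c i • (data k).vec i = (data k).vec j) :
    ∑ l, c (.inl l) - c (.inr west) = gen j 0 ∧
      ∑ l, c (.inl l) * l + c (.inr north) - c (.inr south) = gen j 1 ∧
      ∑ l, c (.inl l) * (l : ℝ) ^ 2 + c (.inr up) - c (.inr down) = gen j 2 := by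
  have hcoord : ∀ a, ∑ i, c i * (gen i a : ℝ) = gen j a := fun a => by
    have := congrFun h a
    rw [Finset.sum_apply] at this
    exact this
  refine ⟨?_, ?_, ?_⟩ <;> rw [← hcoord, Fintype.sum_sum_type, sum_pole] <;> simp [gen] <;> ring

theorem sum_mul_eq_zero_of_sum_mul_sq_eq_zero {c : Ray k → ℝ} (hc : ∀ i, 0 ≤ c i)
    (h : ∑ l, c (.inl l) * (l : ℝ) ^ 2 = 0) : ∑ l, c (.inl l) * l = 0 := by
  rw [Finset.sum_eq_zero_iff_of_nonneg fun l _ => mul_nonneg (hc _) (sq_nonneg _)] at h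
  refine Finset.sum_eq_zero fun l hl => ?_
  simpa using h l hl

theorem vec_down : (data k).vec (.inr down) = -(data k).vec (.inr up) := by
  funext a
  fin_cases a <;> simp [ConvexFanData.vec, data, intVec, gen]

theorem vec_up : (data k).vec (.inr up) = -(data k).vec (.inr down) := by
  rw [vec_down, neg_neg]

theorem vec_south : (data k).vec (.inr south) = -(data k).vec (.inr north) := by
  funext a
  fin_cases a <;> simp [ConvexFanData.vec, data, intVec, gen]

/-- A vector `(1, m, m ^ 2)` is not a positive combination of at most two other ray generators
different from `(0, 0, ±1)`. -/
theorem slope_not_combination {c : Ray k → ℝ} (hc : ∀ i, 0 ≤ c i) {m : Fin (k + 1)}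
    (hm : c (.inl m) = 0) (hup : c (.inr up) = 0) (hdown : c (.inr down) = 0)
    (hcard : {i | 0 < c i}.ncard ≤ 2)
    (hsum : ∑ i, c i • (data k).vec i = (data k).vec (.inl m)) : False := by
  obtain ⟨h0, h1, h2⟩ := coords_of_sum_eq hsum
  rw [hup, hdown] at h2
  simp [gen] at h0 h1 h2
  -- Only slopes have a positive first coordinate.
  obtain ⟨p, hp⟩ : ∃ p, 0 < c (.inl p) := by
    by_contra! h
    rw [Finset.sum_eq_zero fun l _ => le_antisymm (h l) (hc _)] at h0
    linarith [hc (.inr west)]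
  have hpm : p ≠ m := by
    rintro rfl
    exact hp.ne' hm
  have hpm' : (p : ℝ) ≠ m := by simpa [Fin.ext_iff] using hpm
  obtain ⟨q, hq⟩ : ∃ q, ∀ i, i ≠ .inl p → i ≠ q → c i = 0 := by
    have hle : ({i | 0 < c i} \ {.inl p}).ncard ≤ 1 := by
      rw [Set.ncard_sdiff_singleton_of_mem (show (.inl p : Ray k) ∈ {i | 0 < c i} from hp)]
      omega
    obtain ⟨q, hq⟩ := (Set.ncard_le_one_iff_subset_singleton (Set.toFinite _)).1 hle
    refine ⟨q, fun i hip hiq => ?_⟩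
    by_contra h
    exact hiq (hq ⟨lt_of_le_of_ne (hc i) (Ne.symm h), hip⟩)
  rcases q with q | q
  · have hw : c (.inr west) = 0 := hq _ (by simp) (by simp)
    have hn : c (.inr north) = 0 := hq _ (by simp) (by simp)
    have hs : c (.inr south) = 0 := hq _ (by simp) (by simp)
    -- With slopes only, the weights have total 1, mean `m` and second moment `m ^ 2`; their
    -- variance vanishes, so all weight sits at `m`.
    have hvar : ∑ l, c (.inl l) * ((l : ℝ) - m) ^ 2 = 0 := by
      have : ∀ l : Fin (k + 1), c (.inl l) * ((l : ℝ) - m) ^ 2 =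
          c (.inl l) * (l : ℝ) ^ 2 - 2 * m * (c (.inl l) * l) + m ^ 2 * c (.inl l) :=
        fun l => by ring
      simp only [this, Finset.sum_add_distrib, Finset.sum_sub_distrib, ← Finset.mul_sum]
      linear_combination h2 - 2 * m * h1 + m ^ 2 * h0 + m ^ 2 * hw + 2 * m * hn - 2 * m * hs
    rw [Finset.sum_eq_zero_iff_of_nonneg fun l _ => mul_nonneg (hc _) (sq_nonneg _)] at hvar
    have := hvar p (Finset.mem_univ p)
    simp [hp.ne', sub_eq_zero, hpm'] at this
  · have hsum1 : ∀ f : Fin (k + 1) → ℝ, ∑ l, c (.inl l) * f l = c (.inl p) * f p := fun f => by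
      refine Finset.sum_eq_single p (fun l _ hl => ?_) (by simp)
      rw [hq (.inl l) (by simpa using hl) (by simp), zero_mul]
    have hsum0 : ∑ l, c (.inl l) = c (.inl p) := by simpa using hsum1 1
    rw [hsum0] at h0
    rw [hsum1] at h1 h2
    -- With west, the last two coordinates force `m = 0` or `p = m`. Otherwise `c (.inl p) = 1`, and
    -- the third coordinate gives `p ^ 2 = m ^ 2`.
    by_cases hqw : q = west
    · have hn : c (.inr north) = 0 := hq _ (by simp) (by simp [hqw])
      have hs : c (.inr south) = 0 := hq _ (by simp) (by simp [hqw])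
      rw [hn, hs] at h1
      have h3 : (m : ℝ) * (p - m) = 0 := by linear_combination h2 - p * h1
      rcases mul_eq_zero.1 h3 with h | h
      · rw [h] at h1
        have : (p : ℝ) = 0 := by
          have : c (.inl p) * (p : ℝ) = 0 := by linarith
          exact (mul_eq_zero.1 this).resolve_left hp.ne'
        exact hpm' (this.trans h.symm)
      · exact hpm' (sub_eq_zero.1 h)
    · have hw : c (.inr west) = 0 := hq _ (by simp) (by simpa using Ne.symm hqw)
      have hp1 : c (.inl p) = 1 := by linarith
      rw [hp1, one_mul] at h2
      exact hpm' ((sq_eq_sq₀ (by positivity) (by positivity)).1 (by linarith))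

/-- Every ray of the fan is a ray of each of its unimodular coarsenings. -/
theorem cone_singleton_mem {𝒩 : PolyhedralFan 3} (href : (data k).fan.Refines 𝒩)
    (huni : 𝒩.IsUnimodular) (j : Ray k) : (data k).cone {j} ∈ 𝒩.cones := by
  by_contra hj
  obtain ⟨c, hc, hcj, hsum, hli, hadj, hspan⟩ :=
    (data k).exists_positive_combination_of_not_mem href huni hj
  rcases j with m | p
  · obtain ⟨s, hs⟩ := exists_edge_of_slope m
    have hcell : ∀ b, (.inl m : Ray k) ∈ (data k).cell (b, s) := fun b => .inr (.inl hs)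
    have hup : c (.inr up) = 0 := hadj (false, s) (hcell _) (.inr down) (.inl rfl) _ vec_up
    have hdown : c (.inr down) = 0 := hadj (true, s) (hcell _) (.inr up) (.inl rfl) _ vec_down
    refine slope_not_combination hc hcj hup hdown ?_ hsum
    have hnot : (.inr up : Ray k) ∉ {i | 0 < c i} := by simp [hup]
    -- The support stays independent after adding the upper pole, so in dimension three it has at
    -- most two elements.
    have h := (hli.insert (hspan (true, s) (false, s) (hcell _) (hcell _) (.inr up) (.inl rfl)
      (.inr down) (.inl rfl) vec_down)).encard_le_toENat_rank
    rw [rank_fin_fun, Cardinal.toENat_nat, ← (Set.toFinite _).cast_ncard_eq,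
      Set.ncard_insert_of_notMem hnot] at h
    have h' : {i | 0 < c i}.ncard + 1 ≤ 3 := by exact_mod_cast h
    omega
  · obtain ⟨h0, h1, h2⟩ := coords_of_sum_eq hsum
    have hs0 : 0 ≤ ∑ l, c (.inl l) := Finset.sum_nonneg fun l _ => hc _
    have hs1 : 0 ≤ ∑ l, c (.inl l) * (l : ℝ) :=
      Finset.sum_nonneg fun l _ => mul_nonneg (hc _) (by positivity)
    have hs2 : 0 ≤ ∑ l, c (.inl l) * (l : ℝ) ^ 2 :=
      Finset.sum_nonneg fun l _ => mul_nonneg (hc _) (by positivity)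
    have hup := hc (.inr up)
    have hdown := hc (.inr down)
    have hnorth := hc (.inr north)
    have hsouth := hc (.inr south)
    cases p <;> simp [gen] at h0 h1 h2
    -- For the upper pole, the second coordinate removes all slopes with `l ≠ 0`, so nothing with
    -- positive third coordinate remains.
    · have hs : c (.inr south) = 0 :=
        hadj (true, .inr northEast) (.inl rfl) (.inr north) (.inr (.inr rfl)) _ vec_south
      have hzero : ∑ l, c (.inl l) * (l : ℝ) = 0 := by linarith
      have hzero' : ∑ l, c (.inl l) * (l : ℝ) ^ 2 = 0 := by
        rw [Finset.sum_eq_zero_iff_of_nonneg fun l _ => mul_nonneg (hc _) (by positivity)] at hzero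
        exact Finset.sum_eq_zero fun l hl => by rw [sq, ← mul_assoc, hzero l hl, zero_mul]
      linarith
    · linarith
    -- For north, the third coordinate removes the slopes with `l ≠ 0`, so nothing with positive
    -- second coordinate remains.
    · have hup' : c (.inr up) = 0 :=
        hadj (false, .inr northEast) (.inr (.inr rfl)) (.inr down) (.inl rfl) _ vec_up
      have hdown' : c (.inr down) = 0 :=
        hadj (true, .inr northEast) (.inr (.inr rfl)) (.inr up) (.inl rfl) _ vec_down
      have := sum_mul_eq_zero_of_sum_mul_sq_eq_zero hc (by linarith)
      linarith
    · linarith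
    · linarith

end SlopeFan

/-- For every `k` there is a complete unimodular polytopal fan in `ℝ³` with `k + 6` rays that
is not a proper refinement of any unimodular fan. -/
theorem exists_fan_not_properlyRefines (k : ℕ) : ∃ 𝒩 : PolyhedralFan 3,
    𝒩.IsComplete ∧ 𝒩.IsUnimodular ∧ 𝒩.IsPolytopal ∧ 𝒩.rays.ncard = k + 6 ∧
      ∀ 𝒩' : PolyhedralFan 3, 𝒩'.IsUnimodular → ¬ 𝒩.ProperlyRefines 𝒩' := by
  let D := SlopeFan.data k
  refine ⟨D.fan, D.isComplete_fan, D.isUnimodular_fan, D.isPolytopal_fan,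
    D.ncard_rays_fan.trans (SlopeFan.card_ray k), fun 𝒩' huni h => h.2 ?_⟩
  exact D.fan_eq_of_cone_singleton_mem h.1 huni (SlopeFan.cone_singleton_mem h.1 huni)

theorem mainTheorem5 :
    (∀ k : ℕ, ∃ 𝒩 : PolyhedralFan 3,
      𝒩.IsComplete ∧ 𝒩.IsUnimodular ∧ 𝒩.IsPolytopal ∧ 𝒩.rays.ncard = k + 6 ∧
        ∀ 𝒩' : PolyhedralFan 3, 𝒩'.IsUnimodular → ¬ 𝒩.ProperlyRefines 𝒩') ∧
    ¬ ∃ N : ℕ, ∀ 𝒩 : PolyhedralFan 3,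
      𝒩.IsComplete → 𝒩.IsUnimodular → 𝒩.IsPolytopal →
        ∃ 𝒩' : PolyhedralFan 3, 𝒩'.IsUnimodular ∧ 𝒩'.rays.ncard ≤ N ∧ 𝒩.Refines 𝒩' := by
  refine ⟨exists_fan_not_properlyRefines, ?_⟩
  rintro ⟨N, hN⟩
  -- The minimal fan with `N + 6` rays refines no unimodular fan except itself.
  obtain ⟨𝒩, hcomplete, huni, hpoly, hrays, hmin⟩ := exists_fan_not_properlyRefines N
  obtain ⟨𝒩', huni', hle, href⟩ := hN 𝒩 hcomplete huni hpoly
  by_cases h : 𝒩 = 𝒩'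
  · rw [← h, hrays] at hle
    omega
  · exact hmin 𝒩' huni' ⟨href, h⟩
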